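/- A function $F$ belongs to the Selberg class $\mathcal S$ if: (i) $F(s)=\sum_{n\ge1}a(n)n^{-s}$, absolutely convergent for $\Re s>1$, with $a(n)\ll_\varepsilon n^{\varepsilon}$ for every $\varepsilon>0$; (ii) $(s-1)^mF(s)$ extends to an entire function of finite order for some integer $m\ge0$; (iii) for some $r\ge 0$, $Q>0$, $\lambda_j>0$, $\Re\mu_j\ge0$ and $|\omega|=1$, $$Q^s\prod_{j=1}^r\Gamma(\lambda_js+\mu_j)F(s)=\omega Q^{1-s}\prod_{j=1}^r\Gamma(\lambda_j(1-s)+\overline{\mu_j})\,\overline{F(1-\overline s)}$$ as an identity of meromorphic functions; (iv) $\log F(s)=\sum_{n\ge 1} b(n)n^{-s}$ for $\Re s>1$, where $b(n)=0$ unless $n=p^m$ with $p$ prime and $m\ge1$, and $b(n)\ll n^{\theta}$ for some $\theta<1/2$. For $F\in\mathcal S$ let $N_F(\sigma,T)$ be the number of zeros $\rho=\beta+i\gamma$ of $F$, counted with multiplicity, with $\beta>\sigma$ and $|\gamma|\le T$, and let $$\sigma_D(F)=\inf\{\sigma\in\mathbb R: N_F(\sigma,T)=o(T)\ \text{as } T\to\infty\}\in[-\infty,\infty].$$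 Let $\delta>0$. A function $f$, holomorphic in the half-plane $\Re s>1-\delta$, is called a $\delta$-almost periodic majorant of $F$ if, for some $A>1$, the function $t\mapsto f(A+it)$ is almost periodic on $\mathbb R$ in the sense of Bohr, and there is a positive continuous function $c$ on $(1-\delta,\infty)$ with $|F(s)|\le c(\Re s)\,|f(s)|$ for $\Re s>1-\delta$. **Theorem 2.** Let $F\in\mathcal S$, let $\delta>0$, and let $f$ be a $\delta$-almost periodic majorant of $F$. Then $F$ and $f$ have the same zeros, with the same multiplicities, in the half-plane $\Re s>\max(1-\delta,\sigma_D(F))$. -/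

import Mathlib

open Filter Topology Asymptotics
open scoped ComplexConjugate

/-- `F` belongs to the Selberg class. The function `F : ℂ → ℂ` carries its analytic continuation;
its value at the possible pole `s = 1` is pinned by `normalForm`: either `F` is analytic at `1`, or
it has a genuine pole there (and then the value is the conventional `0`). -/
structure IsSelbergClass (F : ℂ → ℂ) : Prop where
  /-- `F` is an absolutely convergent Dirichlet series for `σ > 1`, and its coefficients satisfy
  the Ramanujan condition `a(n) ≪ n ^ ε`. -/
  dirichletSeries : ∃ a : ℕ → ℂ,
    (∀ s : ℂ, 1 < s.re → LSeriesSummable a s ∧ F s = LSeries a s) ∧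
    ∀ ε : ℝ, 0 < ε → a =O[atTop] fun n : ℕ => (n : ℝ) ^ ε
  /-- `(s - 1) ^ m * F s` is entire of finite order for some `m ≥ 0`. -/
  continuation : ∃ (m : ℕ) (G : ℂ → ℂ), Differentiable ℂ G ∧
    (∃ (C : ℝ) (k : ℕ), ∀ s, ‖G s‖ ≤ C * Real.exp (‖s‖ ^ k)) ∧
    ∀ s : ℂ, s ≠ 1 → G s = (s - 1) ^ m * F s
  normalForm : MeromorphicNFAt F 1
  /-- Functional equation of Riemann type. It is an identity of meromorphic functions, so it is
  stated off the possible poles of the Gamma factors and of `F s`, `F (1 - conj s)`.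
  The number `r` of Gamma factors may be `0`. -/
  functionalEquation : ∃ (r : ℕ) (Q : ℝ) (lam : Fin r → ℝ) (mu : Fin r → ℂ) (ω : ℂ),
    0 < Q ∧ (∀ j, 0 < lam j) ∧ (∀ j, 0 ≤ (mu j).re) ∧ ‖ω‖ = 1 ∧
    ∀ s : ℂ, s ≠ 0 → s ≠ 1 →
      (∀ (j : Fin r) (n : ℕ), (lam j : ℂ) * s + mu j ≠ -(n : ℂ)) →
      (∀ (j : Fin r) (n : ℕ), (lam j : ℂ) * (1 - s) + conj (mu j) ≠ -(n : ℂ)) →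
      (Q : ℂ) ^ s * (∏ j, Complex.Gamma ((lam j : ℂ) * s + mu j)) * F s =
        ω * (Q : ℂ) ^ (1 - s) * (∏ j, Complex.Gamma ((lam j : ℂ) * (1 - s) + conj (mu j))) *
          conj (F (1 - conj s))
  /-- Euler product: `log F(s) = ∑ b(n) n ^ (-s)` for `σ > 1`, where `b` is supported on the prime
  powers `p ^ m`, `m ≥ 1`, and `b(n) ≪ n ^ θ` for some `θ < 1 / 2`. -/
  eulerProduct : ∃ b : ℕ → ℂ,
    (∀ n, ¬ IsPrimePow n → b n = 0) ∧
    (∃ θ : ℝ, θ < 1 / 2 ∧ b =O[atTop] fun n : ℕ => (n : ℝ) ^ θ) ∧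
    ∀ s : ℂ, 1 < s.re → LSeriesSummable b s ∧ F s = Complex.exp (LSeries b s)

/-- `N_F(σ, T)`: the number of zeros `ρ = β + iγ` of `F` with `β > σ` and `|γ| ≤ T`, counted with
multiplicity. Points that are not zeros (and a pole) have `analyticOrderAt` equal to `0`, so they
contribute nothing. -/
noncomputable def zeroCount (F : ℂ → ℂ) (σ T : ℝ) : ENNReal :=
  ∑' ρ : {ρ : ℂ // σ < ρ.re ∧ |ρ.im| ≤ T}, (analyticOrderAt F ρ : ENNReal)

/-- The density abscissa `σ_D(F) = inf {σ : N_F(σ, T) = o(T)}`, in the extended reals (it is `-∞`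
for the constant function `1`). -/
noncomputable def densityAbscissa (F : ℂ → ℂ) : EReal :=
  sInf ((fun σ : ℝ => (σ : EReal)) ''
    {σ : ℝ | Tendsto (fun T : ℝ => zeroCount F σ T / ENNReal.ofReal T) atTop (𝓝 0)})

/-- Almost periodic functions on `ℝ` in the sense of Bohr: continuous, and for every `ε > 0` the
`ε`-almost periods meet every interval of some fixed length. -/
def IsAlmostPeriodic (g : ℝ → ℂ) : Prop :=
  Continuous g ∧ ∀ ε : ℝ, 0 < ε → ∃ L : ℝ, 0 < L ∧
    ∀ x : ℝ, ∃ τ ∈ Set.Icc x (x + L), ∀ t : ℝ, ‖g (t + τ) - g t‖ < ε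

/-- `f` is a `δ`-almost periodic majorant of `F`. -/
structure IsAlmostPeriodicMajorant (δ : ℝ) (F f : ℂ → ℂ) : Prop where
  holomorphic : DifferentiableOn ℂ f {s : ℂ | 1 - δ < s.re}
  almostPeriodic : ∃ A : ℝ, 1 < A ∧
    IsAlmostPeriodic fun t : ℝ => f ((A : ℂ) + (t : ℂ) * Complex.I)
  majorant : ∃ c : ℝ → ℝ, ContinuousOn c (Set.Ioi (1 - δ)) ∧ (∀ x, 1 - δ < x → 0 < c x) ∧
    ∀ s : ℂ, 1 - δ < s.re → ‖F s‖ ≤ c s.re * ‖f s‖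

/-!
The quotient `h = F / f` is locally bounded because `f` majorizes `F`, so it extends to a
holomorphic function on `Re s > 1 - δ` with `F = h * f` and `|h(s)| ≤ c(Re s)`; in particular `h`
is bounded on closed vertical strips. The same majorization excludes a pole of `F` at `1`. It
remains to show that `h` has no zero to the right of `max (1 - δ) σ_D(F)`.

On the line `Re s = A` given with the majorant, `F` is almost periodic, being an absolutely
convergent Dirichlet series, and it is bounded away from zero by its Euler product. Hence `f` is
bounded away from zero there too, and `h` is almost periodic on that line. By the three lines
theorem applied to `h(s + iτ) - h(s)`, almost periods on the line are almost periods in strips to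
the left of it (`exists_almostPeriod_in_strip`). So a zero `s` of `h` would recur near `s + iτ` for
relatively dense heights `τ` (`exists_relativelyDense_zeros`). These zeros are zeros of `F`, and
there are more than a constant times `T` of them up to height `T`, to the right of some `σ` with
`N_F(σ, T) = o(T)`, which is impossible (`not_tendsto_zeroCount_div`).

Common almost periods of `F` and `f` are needed for the quotient. They come from a pigeonhole
argument, for which almost periodicity is replaced by total boundedness of the set of translates.
-/

/-! ### Almost periodicity through finitely many translates -/

/-- The translates of `g` form a totally bounded set for the supremum norm: for every `ε > 0`,
finitely many of them are `ε`-dense among all. Bohr almost periodicity implies it, and unlike the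
definition through almost periods it passes to pairs of functions at once. -/
def TranslatesTotallyBounded (g : ℝ → ℂ) : Prop :=
  ∀ ε : ℝ, 0 < ε → ∃ S : Set ℝ, S.Finite ∧ ∀ τ, ∃ σ ∈ S, ∀ t, ‖g (t + τ) - g (t + σ)‖ < ε

theorem IsAlmostPeriodic.uniform_continuity {g : ℝ → ℂ} (hg : IsAlmostPeriodic g) {ε : ℝ}
    (hε : 0 < ε) : ∃ η > 0, ∀ x y, |x - y| < η → ‖g x - g y‖ < ε := by
  obtain ⟨L, hL, hper⟩ := hg.2 (ε / 3) (by positivity)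
  have huc := (isCompact_Icc (a := (-1 : ℝ)) (b := L + 1)).uniformContinuousOn_of_continuous
    hg.1.continuousOn
  obtain ⟨η, hη, hclose⟩ := Metric.uniformContinuousOn_iff.1 huc (ε / 3) (by positivity)
  refine ⟨min η 1, by positivity, fun x y hxy => ?_⟩
  obtain ⟨p, ⟨hp₁, hp₂⟩, hp⟩ := hper (-x)
  have hxy₁ := abs_lt.1 (hxy.trans_le (min_le_right _ _))
  have h := hclose (x + p) ⟨by linarith, by linarith⟩ (y + p) ⟨by linarith, by linarith⟩ (by
    rw [Real.dist_eq]; simpa using hxy.trans_le (min_le_left _ _))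
  rw [dist_eq_norm] at h
  have hx := hp x
  have hy := hp y
  rw [norm_sub_rev] at hx
  calc ‖g x - g y‖ = ‖(g x - g (x + p)) + (g (x + p) - g (y + p)) + (g (y + p) - g y)‖ := by
        congr 1; ring
    _ ≤ ‖g x - g (x + p)‖ + ‖g (x + p) - g (y + p)‖ + ‖g (y + p) - g y‖ := norm_add₃_le
    _ < ε := by linarith

theorem IsAlmostPeriodic.translatesTotallyBounded {g : ℝ → ℂ} (hg : IsAlmostPeriodic g) :
    TranslatesTotallyBounded g := by
  intro ε hε
  obtain ⟨L, hL, hper⟩ := hg.2 (ε / 2) (by positivity)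
  obtain ⟨η, hη, hclose⟩ := hg.uniform_continuity (half_pos hε)
  obtain ⟨S, hS, hcover⟩ :=
    Metric.totallyBounded_iff.1 (isCompact_Icc (a := (0 : ℝ)) (b := L)).totallyBounded η hη
  refine ⟨S, hS, fun τ => ?_⟩
  -- An almost period moves `τ` into `[0, L]`, where the net `S` is dense.
  obtain ⟨p, ⟨hp₁, hp₂⟩, hp⟩ := hper (-τ)
  have hmem := hcover (show τ + p ∈ Set.Icc 0 L from ⟨by linarith, by linarith⟩)
  simp only [Set.mem_iUnion, Metric.mem_ball, Real.dist_eq] at hmem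
  obtain ⟨σ, hσ, hdist⟩ := hmem
  refine ⟨σ, hσ, fun t => ?_⟩
  have h₁ := hp (t + τ)
  rw [norm_sub_rev] at h₁
  have h₂ := hclose (t + τ + p) (t + σ) (by convert hdist using 2; ring)
  calc ‖g (t + τ) - g (t + σ)‖
      = ‖(g (t + τ) - g (t + τ + p)) + (g (t + τ + p) - g (t + σ))‖ := by congr 1; ring
    _ ≤ _ := norm_add_le _ _
    _ < ε := by linarith

/-- A map from `ℝ` to a finite set takes all its values on a bounded set. -/
theorem exists_bounded_representatives {κ : Type*} [Finite κ] (q : ℝ → κ) :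
    ∃ M : ℝ, 0 ≤ M ∧ ∀ τ, ∃ σ, |σ| ≤ M ∧ q τ = q σ := by
  classical
  have hrep : ∀ k : κ, ∃ σ, (∃ τ, q τ = k) → q σ = k := fun k => by
    by_cases h : ∃ τ, q τ = k
    · exact ⟨h.choose, fun _ => h.choose_spec⟩
    · exact ⟨0, fun h' => absurd h' h⟩
  choose rep hrep using hrep
  obtain ⟨M, hM⟩ := (Set.finite_range fun k => |rep k|).bddAbove
  refine ⟨max M 0, le_max_right _ _, fun τ => ⟨rep (q τ), ?_, (hrep _ ⟨τ, rfl⟩).symm⟩⟩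
  exact (hM ⟨q τ, rfl⟩).trans (le_max_left _ _)

/-- Common almost periods of two functions are relatively dense. Each `τ` is coloured by the net
elements which approximate its translates; the difference of two points of the same colour is a
common almost period. -/
theorem TranslatesTotallyBounded.exists_common_almostPeriod {g k : ℝ → ℂ}
    (hg : TranslatesTotallyBounded g) (hk : TranslatesTotallyBounded k) {ε : ℝ} (hε : 0 < ε) :
    ∃ L : ℝ, 0 ≤ L ∧ ∀ x : ℝ, ∃ τ ∈ Set.Icc x (x + L),
      ∀ t, ‖g (t + τ) - g t‖ < ε ∧ ‖k (t + τ) - k t‖ < ε := by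
  obtain ⟨S₁, hS₁, h₁⟩ := hg (ε / 2) (by positivity)
  obtain ⟨S₂, hS₂, h₂⟩ := hk (ε / 2) (by positivity)
  choose q₁ hq₁ h₁ using h₁
  choose q₂ hq₂ h₂ using h₂
  have := hS₁.to_subtype
  have := hS₂.to_subtype
  obtain ⟨M, hM, hrep⟩ := exists_bounded_representatives
    fun τ => ((⟨q₁ τ, hq₁ τ⟩, ⟨q₂ τ, hq₂ τ⟩) : S₁ × S₂)
  refine ⟨2 * M, by positivity, fun x => ?_⟩
  obtain ⟨σ, hσ, heq⟩ := hrep (x + M)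
  simp only [Prod.mk.injEq, Subtype.mk.injEq] at heq
  have key : ∀ (u : ℝ → ℂ) (ρ : ℝ), (∀ t, ‖u (t + (x + M)) - u (t + ρ)‖ < ε / 2) →
      (∀ t, ‖u (t + σ) - u (t + ρ)‖ < ε / 2) → ∀ t, ‖u (t + (x + M - σ)) - u t‖ < ε := by
    intro u ρ hx hs t
    have hx := hx (t - σ)
    have hs := hs (t - σ)
    rw [norm_sub_rev] at hs
    rw [sub_add_cancel] at hs
    calc ‖u (t + (x + M - σ)) - u t‖
        = ‖(u (t - σ + (x + M)) - u (t - σ + ρ)) + (u (t - σ + ρ) - u t)‖ := by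
          rw [sub_add_sub_cancel]; congr 3; ring
      _ ≤ _ := norm_add_le _ _
      _ < ε := by linarith
  have hσ' := abs_le.1 hσ
  refine ⟨x + M - σ, ⟨by linarith, by linarith⟩, fun t => ⟨?_, ?_⟩⟩
  · exact key g (q₁ σ) (heq.1 ▸ h₁ (x + M)) (h₁ σ) t
  · exact key k (q₂ σ) (heq.2 ▸ h₂ (x + M)) (h₂ σ) t

/-- An absolutely convergent trigonometric series has totally bounded translates: up to a small
tail, a translate depends on finitely many phases, which range over a bounded set of `ℂ ^ N`. -/
theorem translatesTotallyBounded_tsum_exp {c : ℕ → ℂ} (hc : Summable fun n => ‖c n‖) (ν : ℕ → ℝ) :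
    TranslatesTotallyBounded fun t => ∑' n, c n * Complex.exp (((ν n * t : ℝ) : ℂ) * Complex.I) := by
  intro ε hε
  set w : ℕ → ℝ → ℂ := fun n t => Complex.exp (((ν n * t : ℝ) : ℂ) * Complex.I)
  have hw : ∀ n t, ‖w n t‖ = 1 := fun n t => Complex.norm_exp_ofReal_mul_I _
  have hw_add : ∀ n t τ, w n (t + τ) = w n t * w n τ := fun n t τ => by
    simp only [w, ← Complex.exp_add]; congr 1; push_cast; ring
  have hsum : ∀ t, Summable fun n => c n * w n t := fun t =>
    Summable.of_norm (by simpa [hw] using hc)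
  set C := ∑' n, ‖c n‖
  have hC : 0 ≤ C := tsum_nonneg fun _ => norm_nonneg _
  obtain ⟨N, hN⟩ : ∃ N, ∑' n, ‖c (n + N)‖ < ε / 4 :=
    ((tendsto_sum_nat_add fun n => ‖c n‖).eventually_lt_const (by positivity)).exists
  set η := ε / (4 * (C + 1)) with hη_def
  have hη : 0 < η := by positivity
  let W : ℝ → (Fin N → ℂ) := fun τ n => w n τ
  have hbdd : Bornology.IsBounded (Set.range W) := by
    refine isBounded_iff_forall_norm_le.2 ⟨1, ?_⟩
    rintro _ ⟨τ, rfl⟩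
    exact (pi_norm_le_iff_of_nonneg zero_le_one).2 fun n => (hw _ _).le
  have htb : TotallyBounded (Set.range W) :=
    hbdd.isCompact_closure.totallyBounded.subset subset_closure
  obtain ⟨Y, hYsub, hY, hcover⟩ := totallyBounded_iff_subset.1 htb _ (Metric.dist_mem_uniformity hη)
  obtain ⟨S, hSY, hS⟩ : ∃ S : Set ℝ, W '' S = Y ∧ S.Finite := by
    choose! r hr using hYsub
    exact ⟨r '' Y, by rw [← Set.image_comp]; exact (Set.image_congr hr).trans (Set.image_id _),
      hY.image r⟩
  refine ⟨S, hS, fun τ => ?_⟩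
  have hmem := hcover ⟨τ, rfl⟩
  simp only [Set.mem_iUnion] at hmem
  obtain ⟨y, hy, hdist⟩ := hmem
  obtain ⟨σ, hσ, rfl⟩ := hSY ▸ hy
  refine ⟨σ, hσ, fun t => ?_⟩
  have hd : ∀ n : ℕ, n < N → ‖w n τ - w n σ‖ ≤ η := fun n hn => by
    rw [← dist_eq_norm]
    exact (dist_le_pi_dist (W τ) (W σ) ⟨n, hn⟩).trans (le_of_lt hdist)
  have hterm : ∀ n, ‖c n * w n (t + τ) - c n * w n (t + σ)‖ = ‖c n‖ * ‖w n τ - w n σ‖ :=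
    fun n => by
      rw [hw_add, hw_add, ← mul_sub, ← mul_sub, norm_mul, norm_mul, hw, one_mul]
  have hle2 : ∀ n, ‖w n τ - w n σ‖ ≤ 2 := fun n => by
    refine (norm_sub_le _ _).trans ?_
    rw [hw, hw]; norm_num
  have hsumd : Summable fun n => ‖c n‖ * ‖w n τ - w n σ‖ :=
    Summable.of_nonneg_of_le (fun n => by positivity)
      (fun n => mul_le_mul_of_nonneg_left (hle2 n) (norm_nonneg _)) (hc.mul_right 2)
  change ‖(∑' n, c n * w n (t + τ)) - ∑' n, c n * w n (t + σ)‖ < ε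
  rw [← (hsum _).tsum_sub (hsum _)]
  have hhead : ∑ n ∈ Finset.range N, ‖c n‖ * ‖w n τ - w n σ‖ ≤ C * η := by
    calc _ ≤ ∑ n ∈ Finset.range N, ‖c n‖ * η := Finset.sum_le_sum fun n hn =>
          mul_le_mul_of_nonneg_left (hd n (Finset.mem_range.1 hn)) (norm_nonneg _)
      _ = (∑ n ∈ Finset.range N, ‖c n‖) * η := (Finset.sum_mul _ _ _).symm
      _ ≤ C * η := mul_le_mul_of_nonneg_right
          (hc.sum_le_tsum _ fun _ _ => norm_nonneg _) hη.le
  have hCη : C * η ≤ ε / 4 := by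
    rw [hη_def, ← mul_div_assoc, div_le_iff₀ (by positivity)]
    nlinarith
  have htail : ∑' n, ‖c (n + N)‖ * ‖w (n + N) τ - w (n + N) σ‖ ≤ (∑' n, ‖c (n + N)‖) * 2 := by
    rw [← tsum_mul_right]
    exact ((summable_nat_add_iff N).2 hsumd).tsum_le_tsum
      (fun n => mul_le_mul_of_nonneg_left (hle2 _) (norm_nonneg _))
      (((summable_nat_add_iff N).2 hc).mul_right 2)
  calc ‖∑' n, (c n * w n (t + τ) - c n * w n (t + σ))‖
      ≤ ∑' n, ‖c n * w n (t + τ) - c n * w n (t + σ)‖ :=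
        norm_tsum_le_tsum_norm (by simpa only [hterm] using hsumd)
    _ = ∑' n, ‖c n‖ * ‖w n τ - w n σ‖ := tsum_congr hterm
    _ = (∑ n ∈ Finset.range N, ‖c n‖ * ‖w n τ - w n σ‖) +
        ∑' n, ‖c (n + N)‖ * ‖w (n + N) τ - w (n + N) σ‖ := (hsumd.sum_add_tsum_nat_add N).symm
    _ < ε := by linarith

theorem translatesTotallyBounded_LSeries {a : ℕ → ℂ} {A : ℝ} (ha : LSeriesSummable a A) :
    TranslatesTotallyBounded fun t : ℝ => LSeries a (A + t * Complex.I) := by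
  convert translatesTotallyBounded_tsum_exp (c := LSeries.term a A) ha.norm
    (fun n => -Real.log n) using 2 with t
  refine tsum_congr fun n => ?_
  rcases eq_or_ne n 0 with rfl | hn
  · simp
  have hn' : (n : ℂ) ≠ 0 := Nat.cast_ne_zero.2 hn
  rw [LSeries.term_of_ne_zero hn, LSeries.term_of_ne_zero hn, Complex.cpow_add _ _ hn', ← div_div,
    div_eq_mul_inv (a n / _), ← Complex.cpow_neg, Complex.cpow_def_of_ne_zero hn' (-_),
    ← Complex.natCast_log]
  congr 2
  push_cast
  ring

/-! ### Zeros of functions with almost periods -/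

/-- The minimum principle, in the form that replaces Rouché's theorem here. -/
theorem exists_zero_of_norm_center_lt {h : ℂ → ℂ} {c : ℂ} {r m : ℝ} (hr : 0 < r)
    (hd : DifferentiableOn ℂ h (Metric.closedBall c r)) (hc : ‖h c‖ < m)
    (hm : ∀ z ∈ Metric.sphere c r, m ≤ ‖h z‖) : ∃ z ∈ Metric.closedBall c r, h z = 0 := by
  by_contra! hne
  have hm0 : 0 < m := (norm_nonneg _).trans_lt hc
  have hdiff : DiffContOnCl ℂ (fun z => (h z)⁻¹) (Metric.ball c r) := by
    refine DifferentiableOn.diffContOnCl ?_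
    rw [closure_ball c hr.ne']
    exact hd.inv hne
  have hle := Complex.norm_le_of_forall_mem_frontier_norm_le Metric.isBounded_ball hdiff
    (C := m⁻¹) (fun z hz => by
      rw [frontier_ball c hr.ne'] at hz
      rw [norm_inv]
      exact inv_anti₀ hm0 (hm z hz)) (subset_closure (Metric.mem_ball_self hr))
  rw [norm_inv] at hle
  have := (inv_le_inv₀ (norm_pos_iff.2 (hne c (Metric.mem_closedBall_self hr.le))) hm0).1 hle
  linarith

/-- For a function which is holomorphic and bounded in a strip, an almost period on one edge is an
almost period in the strip, off the other edge. This is the three lines theorem applied to the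
difference of the function and its translate. -/
theorem exists_almostPeriod_in_strip {h : ℂ → ℂ} {σ₀ σ₁ A M η : ℝ} (h01 : σ₀ < σ₁) (h1A : σ₁ ≤ A)
    {U : Set ℂ} (hU : ∀ s : ℂ, σ₀ ≤ s.re → s.re ≤ A → s ∈ U) (hUo : IsOpen U)
    (hd : DifferentiableOn ℂ h U) (hM : ∀ s : ℂ, σ₀ ≤ s.re → s.re ≤ A → ‖h s‖ ≤ M) (hη : 0 < η) :
    ∃ ε > 0, ∀ τ : ℝ,
      (∀ t : ℝ, ‖h (A + (t + τ : ℝ) * Complex.I) - h (A + t * Complex.I)‖ < ε) →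
      ∀ s : ℂ, σ₁ ≤ s.re → s.re ≤ A → ‖h (s + τ * Complex.I) - h s‖ < η := by
  have h0A : σ₀ < A := h01.trans_le h1A
  have hM' : ∀ s : ℂ, σ₀ ≤ s.re → s.re ≤ A → ‖h s‖ ≤ max M 1 := fun s h₁ h₂ =>
    (hM s h₁ h₂).trans (le_max_left _ _)
  have hM1 : 1 ≤ max M 1 := le_max_right _ _
  generalize max M 1 = K at hM' hM1
  set θ := (σ₁ - σ₀) / (A - σ₀) with hθ_def
  have hθ : 0 < θ := div_pos (by linarith) (by linarith)
  set κ := min 1 (η / (4 * K))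
  have hκ : 0 < κ := by positivity
  have hκ1 : κ ≤ 1 := min_le_left _ _
  refine ⟨κ ^ θ⁻¹, by positivity, fun τ hτ s hs₁ hs₂ => ?_⟩
  have hshift : ∀ z : ℂ, (z + τ * Complex.I).re = z.re := fun z => by simp
  have hdd : DifferentiableOn ℂ (fun z => h (z + τ * Complex.I) - h z)
      (Complex.HadamardThreeLines.verticalClosedStrip σ₀ A) := by
    intro z hz
    have h₁ : DifferentiableAt ℂ h z := hd.differentiableAt (hUo.mem_nhds (hU z hz.1 hz.2))
    have h₂ : DifferentiableAt ℂ h (z + τ * Complex.I) := hd.differentiableAt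
      (hUo.mem_nhds (hU _ (by rw [hshift]; exact hz.1) (by rw [hshift]; exact hz.2)))
    exact ((h₂.comp z (by fun_prop : DifferentiableAt ℂ (fun z => z + τ * Complex.I) z)).sub
      h₁).differentiableWithinAt
  have hbound : ∀ z : ℂ, σ₀ ≤ z.re → z.re ≤ A → ‖h (z + τ * Complex.I) - h z‖ ≤ 2 * K :=
    fun z h₁ h₂ => by
      have := hM' z h₁ h₂
      have := hM' (z + τ * Complex.I) (by rwa [hshift]) (by rwa [hshift])
      linarith [norm_sub_le (h (z + τ * Complex.I)) (h z)]
  have hcl : closure (Complex.HadamardThreeLines.verticalStrip σ₀ A) ⊆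
      Complex.HadamardThreeLines.verticalClosedStrip σ₀ A :=
    closure_minimal (Set.preimage_mono Set.Ioo_subset_Icc_self)
      (isClosed_Icc.preimage Complex.continuous_re)
  have h3 := Complex.HadamardThreeLines.norm_le_interp_of_mem_verticalClosedStrip'
    (f := fun z => h (z + τ * Complex.I) - h z) (z := s) (a := 2 * K) (b := κ ^ θ⁻¹) h0A
    ⟨by linarith, hs₂⟩ (DifferentiableOn.diffContOnCl (hdd.mono hcl))
    ⟨2 * K, by rintro _ ⟨z, hz, rfl⟩; exact hbound z hz.1 hz.2⟩
    (fun z hz => hbound z (le_of_eq hz.symm) (by rw [show z.re = σ₀ from hz]; exact h0A.le))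
    (fun z hz => by
      have hzA : z.re = A := hz
      have := (hτ z.im).le
      have e : (A : ℂ) + z.im * Complex.I = z := by
        rw [← hzA]; exact Complex.re_add_im z
      have e' : (A : ℂ) + ((z.im + τ : ℝ) : ℂ) * Complex.I = z + τ * Complex.I := by
        conv_rhs => rw [← e]
        push_cast; ring
      rwa [e, e'] at this)
  have hA0 : 0 < A - σ₀ := by linarith
  set x := (s.re - σ₀) / (A - σ₀)
  have hx1 : x ≤ 1 := (div_le_one hA0).2 (by linarith)
  have hθx : θ ≤ x := div_le_div_of_nonneg_right (by linarith) hA0.le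
  have hK2 : (2 * K) ^ (1 - x) ≤ 2 * K := by
    calc (2 * K) ^ (1 - x) ≤ (2 * K) ^ (1 : ℝ) :=
          Real.rpow_le_rpow_of_exponent_le (by linarith) (by linarith)
      _ = 2 * K := Real.rpow_one _
  have hκx : (κ ^ θ⁻¹) ^ x ≤ κ := by
    calc (κ ^ θ⁻¹) ^ x = κ ^ (θ⁻¹ * x) := (Real.rpow_mul hκ.le _ _).symm
      _ ≤ κ ^ (1 : ℝ) := Real.rpow_le_rpow_of_exponent_ge hκ hκ1 (by
          rw [inv_mul_eq_div]; exact (one_le_div hθ).2 hθx)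
      _ = κ := Real.rpow_one _
  calc ‖h (s + τ * Complex.I) - h s‖ ≤ (2 * K) ^ (1 - x) * (κ ^ θ⁻¹) ^ x := h3
    _ ≤ (2 * K) * κ := mul_le_mul hK2 hκx (by positivity) (by positivity)
    _ ≤ (2 * K) * (η / (4 * K)) :=
        mul_le_mul_of_nonneg_left (min_le_right _ _) (by positivity)
    _ = η / 2 := by field_simp; norm_num
    _ < η := half_lt_self hη

/-- A zero `s₀` of a bounded holomorphic function that is almost periodic on the line `Re s = A`
recurs, with a real part close to that of `s₀`, at relatively dense heights. -/
theorem exists_relativelyDense_zeros {h : ℂ → ℂ} {σ₀ σ₁ A M : ℝ} {U : Set ℂ}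
    (hU : ∀ s : ℂ, σ₀ ≤ s.re → s.re ≤ A → s ∈ U) (hUo : IsOpen U)
    (hd : DifferentiableOn ℂ h U) (hM : ∀ s : ℂ, σ₀ ≤ s.re → s.re ≤ A → ‖h s‖ ≤ M)
    (hper : ∀ ε > 0, ∃ L : ℝ, 0 ≤ L ∧ ∀ x : ℝ, ∃ τ ∈ Set.Icc x (x + L),
      ∀ t : ℝ, ‖h (A + (t + τ : ℝ) * Complex.I) - h (A + t * Complex.I)‖ < ε)
    {s₀ : ℂ} (h01 : σ₀ < σ₁) (h1 : σ₁ < s₀.re) (hA : s₀.re < A) (hzero : h s₀ = 0)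
    (hne : ∀ᶠ z in 𝓝[≠] s₀, h z ≠ 0) :
    ∃ L : ℝ, 0 ≤ L ∧ ∀ x : ℝ, ∃ ρ : ℂ, h ρ = 0 ∧ σ₁ ≤ ρ.re ∧ ρ.re ≤ A ∧
      ρ.im ∈ Set.Icc x (x + L) := by
  obtain ⟨r₁, hr₁, hball⟩ := Metric.mem_nhdsWithin_iff.1 hne
  obtain ⟨r, hr, hlt⟩ : ∃ r > 0, r < min r₁ (min (s₀.re - σ₁) (A - s₀.re)) :=
    exists_between (lt_min hr₁ (lt_min (by linarith) (by linarith)))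
  have hrr₁ := hlt.trans_le (min_le_left _ _)
  have hrσ := hlt.trans_le ((min_le_right _ _).trans (min_le_left _ _))
  have hrA := hlt.trans_le ((min_le_right _ _).trans (min_le_right _ _))
  have hre : ∀ z ∈ Metric.closedBall s₀ r, σ₁ ≤ z.re ∧ z.re ≤ A := fun z hz => by
    rw [mem_closedBall_iff_norm] at hz
    have := abs_le.1 ((Complex.abs_re_le_norm (z - s₀)).trans hz)
    rw [Complex.sub_re] at this
    exact ⟨by linarith, by linarith⟩
  -- The circle `|z - s₀| = r` is compact and free of zeros, so `|h|` is bounded below on it.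
  have hcont : ContinuousOn (fun z => ‖h z‖) (Metric.sphere s₀ r) :=
    (hd.continuousOn.mono fun z hz => by
      have := hre z (Metric.sphere_subset_closedBall hz)
      exact hU z (by linarith) this.2).norm
  obtain ⟨z₁, hz₁, hmin⟩ := (isCompact_sphere s₀ r).exists_isMinOn
    (NormedSpace.sphere_nonempty.2 hr.le) hcont
  have hm : 0 < ‖h z₁‖ := norm_pos_iff.2 (hball ⟨Metric.mem_ball.2 (by
    rw [Metric.mem_sphere.1 hz₁]; exact hrr₁), fun e => by
      rw [Metric.mem_sphere, e, dist_self] at hz₁; linarith⟩)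
  obtain ⟨ε, hε, hstrip⟩ := exists_almostPeriod_in_strip h01 (by linarith) hU hUo hd hM
    (half_pos hm)
  obtain ⟨L, hL, hdense⟩ := hper ε hε
  refine ⟨L + 2 * r, by positivity, fun x => ?_⟩
  obtain ⟨τ, ⟨hτ₁, hτ₂⟩, hτ⟩ := hdense (x + r - s₀.im)
  have hs := hstrip τ hτ
  have hdiff : DifferentiableOn ℂ (fun z => h (z + τ * Complex.I)) (Metric.closedBall s₀ r) := by
    intro z hz
    have := hre z hz
    exact ((hd.differentiableAt (hUo.mem_nhds (hU (z + τ * Complex.I) (by simp; linarith)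
      (by simpa using this.2)))).comp z
      (by fun_prop : DifferentiableAt ℂ (fun z => z + τ * Complex.I) z)).differentiableWithinAt
  obtain ⟨z, hz, hz0⟩ := exists_zero_of_norm_center_lt (m := ‖h z₁‖ / 2) hr hdiff
    (by simpa [hzero] using hs s₀ h1.le hA.le) (fun z hz => by
      have hb := hre z (Metric.sphere_subset_closedBall hz)
      have h₁ := hs z hb.1 hb.2
      have h₂ : ‖h z₁‖ ≤ ‖h z‖ := hmin hz
      have h₃ := norm_sub_norm_le (h z) (h (z + τ * Complex.I))
      rw [norm_sub_rev] at h₃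
      linarith)
  have hb := hre z hz
  rw [mem_closedBall_iff_norm] at hz
  have him := abs_le.1 ((Complex.abs_im_le_norm (z - s₀)).trans hz)
  rw [Complex.sub_im] at him
  exact ⟨z + τ * Complex.I, hz0, by simpa using hb.1, by simpa using hb.2,
    by simp; linarith, by simp; linarith⟩

/-! ### Counting zeros -/

/-- Zeros at relatively dense heights are too many for `N_F(σ, T) = o(T)`. -/
theorem not_tendsto_zeroCount_div {F : ℂ → ℂ} {σ L : ℝ} (hL : 0 ≤ L)
    (hz : ∀ x : ℝ, ∃ ρ : ℂ, analyticOrderAt F ρ ≠ 0 ∧ σ < ρ.re ∧ ρ.im ∈ Set.Icc x (x + L)) :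
    ¬ Tendsto (fun T : ℝ => zeroCount F σ T / ENNReal.ofReal T) atTop (𝓝 0) := by
  intro hlim
  set D := L + 1 with hD_def
  have hD : 0 < D := by positivity
  choose ρ hord hσ hIcc using fun k : ℕ => hz (k * D)
  -- The gap `D > L` makes the zeros found at the heights `k * D` distinct.
  have hmono : StrictMono fun k => (ρ k).im := strictMono_nat_of_lt_succ fun k => by
    have h₁ := (hIcc k).2
    have h₂ := (hIcc (k + 1)).1
    push_cast at h₂
    nlinarith
  have hcount : ∀ n : ℕ, (n : ENNReal) ≤ zeroCount F σ (n * D) := fun n => by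
    have hmem : ∀ k : Fin n, σ < (ρ k).re ∧ |(ρ k).im| ≤ n * D := fun k => by
      have h₁ := (hIcc k).1
      have h₂ := (hIcc k).2
      have h₃ : ((k : ℕ) : ℝ) + 1 ≤ n := by exact_mod_cast k.2
      have h₄ : (0 : ℝ) ≤ (k : ℕ) * D := by positivity
      refine ⟨hσ k, abs_le.2 ⟨by nlinarith, by nlinarith⟩⟩
    let φ : Fin n → {z : ℂ // σ < z.re ∧ |z.im| ≤ n * D} := fun k => ⟨ρ k, hmem k⟩
    have hφ : Function.Injective φ := fun i j hij =>
      Fin.ext (hmono.injective (congrArg (fun z => (z.1 : ℂ).im) hij))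
    calc (n : ENNReal) = ∑' _ : Fin n, 1 := by simp
      _ ≤ ∑' k : Fin n, (analyticOrderAt F (φ k) : ENNReal) := ENNReal.tsum_le_tsum fun k => by
          have := Order.one_le_iff_ne_zero.2 (hord k)
          exact_mod_cast ENat.toENNReal_le.2 this
      _ ≤ _ := ENNReal.tsum_comp_le_tsum_of_injective hφ
          fun z => (analyticOrderAt F z : ENNReal)
  have hseq : Tendsto (fun n : ℕ => (n : ℝ) * D) atTop atTop :=
    tendsto_natCast_atTop_atTop.atTop_mul_const hD
  have hev := (hlim.comp hseq).eventually_lt_const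
    (show (0 : ENNReal) < ENNReal.ofReal D⁻¹ by simpa using hD)
  obtain ⟨n, hn, hpos⟩ := (hev.and (eventually_gt_atTop 0)).exists
  have hnD : (0 : ℝ) < n * D := by positivity
  refine absurd hn (not_lt.2 ?_)
  change _ ≤ zeroCount F σ (n * D) / ENNReal.ofReal (n * D)
  rw [ENNReal.le_div_iff_mul_le (.inl (ENNReal.ofReal_pos.2 hnD).ne') (.inl ENNReal.ofReal_ne_top),
    ← ENNReal.ofReal_mul (by positivity), show D⁻¹ * (n * D) = n by field_simp,
    ENNReal.ofReal_natCast]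
  exact hcount n

/-! ### Dividing by a majorant -/

/-- A quotient of analytic functions which is bounded by a continuous function extends to an
analytic function with the same bound. -/
theorem exists_analytic_quotient {F f : ℂ → ℂ} {U : Set ℂ} {c : ℂ → ℝ}
    (hF : AnalyticOnNhd ℂ F U) (hf : AnalyticOnNhd ℂ f U) (hne : ∀ z ∈ U, ∀ᶠ w in 𝓝[≠] z, f w ≠ 0)
    (hUo : IsOpen U) (hc : ContinuousOn c U) (hle : ∀ z ∈ U, ‖F z‖ ≤ c z * ‖f z‖) :
    ∃ h : ℂ → ℂ, AnalyticOnNhd ℂ h U ∧ (∀ z ∈ U, F z = h z * f z) ∧ ∀ z ∈ U, ‖h z‖ ≤ c z := by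
  have hmer : MeromorphicOn (F / f) U := fun z hz =>
    (hF z hz).meromorphicAt.div (hf z hz).meromorphicAt
  set h := toMeromorphicNFOn (F / f) U
  have hev : ∀ z ∈ U, ∀ᶠ w in 𝓝[≠] z, w ∈ U ∧ f w ≠ 0 ∧ h w = F w / f w := fun z hz => by
    filter_upwards [hne z hz, hmer.toMeromorphicNFOn_eq_self_on_nhdsNE hz,
      mem_nhdsWithin_of_mem_nhds (hUo.mem_nhds hz)] with w h₁ h₂ h₃
    exact ⟨h₃, h₁, h₂⟩
  have hbd : ∀ z ∈ U, ∀ᶠ w in 𝓝[≠] z, ‖h w‖ ≤ c w := fun z hz => by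
    filter_upwards [hev z hz] with w ⟨h₁, h₂, h₃⟩
    rw [h₃, norm_div, div_le_iff₀ (norm_pos_iff.2 h₂)]
    exact hle w h₁
  have hct : ∀ z ∈ U, Tendsto c (𝓝[≠] z) (𝓝 (c z)) := fun z hz =>
    (hc.continuousAt (hUo.mem_nhds hz)).tendsto.mono_left nhdsWithin_le_nhds
  have hNF := meromorphicNFOn_toMeromorphicNFOn (F / f) U
  have han : AnalyticOnNhd ℂ h U := fun z hz => by
    refine (hNF hz).meromorphicOrderAt_nonneg_iff_analyticAt.1 (not_lt.1 fun hlt => ?_)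
    have htop := tendsto_norm_atTop_iff_cobounded.2
      ((tendsto_cobounded_iff_meromorphicOrderAt_neg (hNF hz).meromorphicAt).2 hlt)
    exact not_tendsto_atTop_of_tendsto_nhds (hct z hz) (tendsto_atTop_mono' _ (hbd z hz) htop)
  refine ⟨h, han, fun z hz => ?_, fun z hz => ?_⟩
  · have ht₁ := (hF z hz).continuousAt.tendsto.mono_left (nhdsWithin_le_nhds (s := {z}ᶜ))
    have ht₂ := ((han z hz).mul (hf z hz)).continuousAt.tendsto.mono_left
      (nhdsWithin_le_nhds (s := {z}ᶜ))
    refine tendsto_nhds_unique_of_eventuallyEq ht₁ ht₂ ?_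
    filter_upwards [hev z hz] with w ⟨_, h₂, h₃⟩
    simp [h₃, h₂]
  · exact le_of_tendsto_of_tendsto ((han z hz).continuousAt.norm.tendsto.mono_left
      nhdsWithin_le_nhds) (hct z hz) (hbd z hz)

/-! ### The Selberg class -/

theorem IsSelbergClass.analyticAt_of_ne_one {F : ℂ → ℂ} (hF : IsSelbergClass F) {s : ℂ}
    (hs : s ≠ 1) : AnalyticAt ℂ F s := by
  obtain ⟨m, G, hG, -, hGF⟩ := hF.continuation
  have han : AnalyticAt ℂ (fun z => G z / (z - 1) ^ m) s :=
    (hG.analyticAt s).div (by fun_prop) (pow_ne_zero _ (sub_ne_zero.2 hs))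
  refine han.congr ?_
  filter_upwards [isOpen_ne.mem_nhds hs] with z hz
  rw [hGF z hz, mul_div_cancel_left₀ _ (pow_ne_zero _ (sub_ne_zero.2 hz))]

theorem IsSelbergClass.ne_zero_of_one_lt_re {F : ℂ → ℂ} (hF : IsSelbergClass F) {s : ℂ}
    (hs : 1 < s.re) : F s ≠ 0 := by
  obtain ⟨b, -, -, hb⟩ := hF.eulerProduct
  rw [(hb s hs).2]
  exact Complex.exp_ne_zero _

/-- The Euler product keeps `F` away from zero on each vertical line to the right of `1`. -/
theorem IsSelbergClass.exists_norm_lower_bound {F : ℂ → ℂ} (hF : IsSelbergClass F) {A : ℝ}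
    (hA : 1 < A) : ∃ k > 0, ∀ s : ℂ, s.re = A → k ≤ ‖F s‖ := by
  obtain ⟨b, -, -, hb⟩ := hF.eulerProduct
  have hsum := (hb A (by simpa using hA)).1
  refine ⟨Real.exp (-∑' n, ‖LSeries.term b A n‖), Real.exp_pos _, fun s hs => ?_⟩
  obtain ⟨hbs, hFs⟩ := hb s (by linarith)
  rw [hFs, Complex.norm_exp]
  refine Real.exp_le_exp.2 ?_
  have hnorm : ‖LSeries b s‖ ≤ ∑' n, ‖LSeries.term b A n‖ := by
    refine (norm_tsum_le_tsum_norm hbs.norm).trans_eq (tsum_congr fun n => ?_)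
    rw [LSeries.norm_term_eq, LSeries.norm_term_eq, hs, Complex.ofReal_re]
  linarith [(abs_le.1 ((Complex.abs_re_le_norm (LSeries b s)).trans hnorm)).1]

theorem IsSelbergClass.translatesTotallyBounded {F : ℂ → ℂ} (hF : IsSelbergClass F) {A : ℝ}
    (hA : 1 < A) : TranslatesTotallyBounded fun t : ℝ => F (A + t * Complex.I) := by
  obtain ⟨a, ha, -⟩ := hF.dirichletSeries
  convert translatesTotallyBounded_LSeries (ha A (by simpa using hA)).1 using 2 with t
  exact (ha _ (by simpa using hA)).2

/-- A function with an almost periodic majorant has no pole at `1`. -/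
theorem IsSelbergClass.analyticAt_of_majorant {F f : ℂ → ℂ} {δ : ℝ} (hδ : 0 < δ)
    (hF : IsSelbergClass F) (hf : IsAlmostPeriodicMajorant δ F f) (s : ℂ) : AnalyticAt ℂ F s := by
  rcases eq_or_ne s 1 with rfl | hs
  swap; · exact hF.analyticAt_of_ne_one hs
  refine hF.normalForm.meromorphicOrderAt_nonneg_iff_analyticAt.1 (not_lt.1 fun hlt => ?_)
  obtain ⟨c, hc, -, hle⟩ := hf.majorant
  have htop := tendsto_norm_atTop_iff_cobounded.2
    ((tendsto_cobounded_iff_meromorphicOrderAt_neg hF.normalForm.meromorphicAt).2 hlt)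
  have hmem : {s : ℂ | 1 - δ < s.re} ∈ 𝓝 (1 : ℂ) :=
    (isOpen_lt continuous_const Complex.continuous_re).mem_nhds (by simpa using hδ)
  have hc1 : ContinuousAt (fun z : ℂ => c z.re) 1 :=
    ContinuousAt.comp (f := Complex.re) (hc.continuousAt (Ioi_mem_nhds (by simpa using hδ)))
      Complex.continuous_re.continuousAt
  have hcf := (hc1.mul (hf.holomorphic.differentiableAt hmem).continuousAt.norm).tendsto.mono_left
    (nhdsWithin_le_nhds (s := {1}ᶜ))
  refine not_tendsto_atTop_of_tendsto_nhds hcf (tendsto_atTop_mono' _ ?_ htop)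
  filter_upwards [mem_nhdsWithin_of_mem_nhds hmem] with z hz using hle z hz

/-- If `F = h * f` on `ℝ`, with `h` bounded and `f` bounded away from zero,
then common almost periods of `F` and `f` are almost periods of `h`, because
`f₁ (h₁ - h₀) = (F₁ - F₀) - h₀ (f₁ - f₀)`. -/
theorem exists_almostPeriod_quotient {F f h : ℝ → ℂ} (hF : TranslatesTotallyBounded F)
    (hf : TranslatesTotallyBounded f) {k M : ℝ} (hk : 0 < k) (hfk : ∀ t, k ≤ ‖f t‖)
    (hM : ∀ t, ‖h t‖ ≤ M) (hmul : ∀ t, F t = h t * f t) {ε : ℝ} (hε : 0 < ε) :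
    ∃ L : ℝ, 0 ≤ L ∧ ∀ x : ℝ, ∃ τ ∈ Set.Icc x (x + L), ∀ t, ‖h (t + τ) - h t‖ < ε := by
  have hM0 : 0 ≤ M := (norm_nonneg _).trans (hM 0)
  set ε' := ε * k / (1 + M) with hε'_def
  obtain ⟨L, hL, hper⟩ := hF.exists_common_almostPeriod hf (ε := ε') (by positivity)
  refine ⟨L, hL, fun x => ?_⟩
  obtain ⟨τ, hτ, hτt⟩ := hper x
  refine ⟨τ, hτ, fun t => ?_⟩
  obtain ⟨h₁, h₂⟩ := hτt t
  have hid : f (t + τ) * (h (t + τ) - h t) = (F (t + τ) - F t) - h t * (f (t + τ) - f t) := by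
    rw [hmul, hmul]; ring
  have hlt : k * ‖h (t + τ) - h t‖ < k * ε := by
    calc k * ‖h (t + τ) - h t‖ ≤ ‖f (t + τ)‖ * ‖h (t + τ) - h t‖ :=
          mul_le_mul_of_nonneg_right (hfk _) (norm_nonneg _)
      _ = ‖(F (t + τ) - F t) - h t * (f (t + τ) - f t)‖ := by rw [← norm_mul, hid]
      _ ≤ ‖F (t + τ) - F t‖ + ‖h t‖ * ‖f (t + τ) - f t‖ := by
          rw [← norm_mul]; exact norm_sub_le _ _
      _ < ε' + M * ε' := add_lt_add_of_lt_of_le h₁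
          (mul_le_mul (hM t) h₂.le (norm_nonneg _) hM0)
      _ = k * ε := by rw [hε'_def]; field_simp
  exact lt_of_mul_lt_mul_left hlt hk.le

theorem theorem2 (F f : ℂ → ℂ) (δ : ℝ) (hδ : 0 < δ) (hF : IsSelbergClass F)
    (hf : IsAlmostPeriodicMajorant δ F f) (s : ℂ)
    (hs : max ((1 - δ : ℝ) : EReal) (densityAbscissa F) < (s.re : EReal)) :
    (F s = 0 ↔ f s = 0) ∧ analyticOrderAt F s = analyticOrderAt f s := by
  obtain ⟨hsδ, hsD⟩ := max_lt_iff.1 hs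
  have hsδ : 1 - δ < s.re := EReal.coe_lt_coe_iff.1 hsδ
  obtain ⟨_, ⟨σ, hσ, rfl⟩, hσs⟩ := sInf_lt_iff.1 hsD
  have hσs : σ < s.re := EReal.coe_lt_coe_iff.1 hσs
  set U : Set ℂ := {z : ℂ | 1 - δ < z.re}
  have hUo : IsOpen U := isOpen_lt continuous_const Complex.continuous_re
  have hUc : IsPreconnected U := (convex_halfSpace_re_gt (1 - δ)).isPreconnected
  obtain ⟨c, hc, hcpos, hle⟩ := hf.majorant
  obtain ⟨A, hA, hap⟩ := hf.almostPeriodic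
  have hFan : AnalyticOnNhd ℂ F U := fun z _ => hF.analyticAt_of_majorant hδ hf z
  have hfan : AnalyticOnNhd ℂ f U := hf.holomorphic.analyticOnNhd hUo
  have h2U : (2 : ℂ) ∈ U := by simp [U]; linarith
  have hF2 : F 2 ≠ 0 := hF.ne_zero_of_one_lt_re (by simp)
  have hFne : ∀ z ∈ U, ∀ᶠ w in 𝓝[≠] z, F w ≠ 0 := fun z hz =>
    (hFan z hz).eventually_eq_zero_or_eventually_ne_zero.resolve_left fun h0 =>
      hF2 (hFan.eqOn_zero_of_preconnected_of_eventuallyEq_zero hUc hz h0 h2U)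
  have hfne : ∀ z ∈ U, ∀ᶠ w in 𝓝[≠] z, f w ≠ 0 := fun z hz => by
    filter_upwards [hFne z hz, mem_nhdsWithin_of_mem_nhds (hUo.mem_nhds hz)] with w h₁ h₂ h₃
    have := hle w h₂
    rw [h₃, norm_zero, mul_zero] at this
    exact h₁ (norm_le_zero_iff.1 this)
  have hcre : ContinuousOn (fun z : ℂ => c z.re) U :=
    hc.comp Complex.continuous_re.continuousOn fun z hz => hz
  obtain ⟨h, hhan, hmul, hhc⟩ := exists_analytic_quotient hFan hfan hfne hUo hcre hle
  have hne : h s ≠ 0 := by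
    intro hs0
    have hs1 : s.re < A := by
      by_contra! hge
      exact hF.ne_zero_of_one_lt_re (hA.trans_le hge) (by rw [hmul s hsδ, hs0, zero_mul])
    obtain ⟨σ₁, hσ₁, hσ₁s⟩ := exists_between (max_lt hsδ hσs)
    obtain ⟨σ₀, hσ₀, hσ₀₁⟩ := exists_between ((le_max_left _ _).trans_lt hσ₁)
    have hsub : Set.Icc σ₀ A ⊆ Set.Ioi (1 - δ) := fun x hx => hσ₀.trans_le hx.1
    obtain ⟨M, hM⟩ := isCompact_Icc.bddAbove_image (hc.mono hsub)
    have hstrip : ∀ z : ℂ, σ₀ ≤ z.re → z.re ≤ A → z ∈ U := fun z h₁ _ => hσ₀.trans_le h₁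
    have hhM : ∀ z : ℂ, σ₀ ≤ z.re → z.re ≤ A → ‖h z‖ ≤ M := fun z h₁ h₂ =>
      (hhc z (hstrip z h₁ h₂)).trans (hM ⟨z.re, ⟨h₁, h₂⟩, rfl⟩)
    have hline : ∀ t : ℝ, ((A : ℂ) + t * Complex.I).re = A := fun t => by simp
    have hAδ : 1 - δ < A := by linarith
    obtain ⟨k, hk, hkF⟩ := hF.exists_norm_lower_bound hA
    have hper : ∀ ε > 0, ∃ L : ℝ, 0 ≤ L ∧ ∀ x : ℝ, ∃ τ ∈ Set.Icc x (x + L),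
        ∀ t : ℝ, ‖h (A + (t + τ : ℝ) * Complex.I) - h (A + t * Complex.I)‖ < ε := fun ε hε =>
      exists_almostPeriod_quotient (h := fun t : ℝ => h (A + t * Complex.I))
        (hF.translatesTotallyBounded hA) hap.translatesTotallyBounded
        (div_pos hk (hcpos A hAδ))
        (fun t => by
          rw [div_le_iff₀' (hcpos A hAδ)]
          have h₁ := hle (A + t * Complex.I) (by rw [hline]; exact hAδ)
          rw [hline] at h₁
          exact (hkF _ (hline t)).trans h₁)
        (fun t => hhM _ (by rw [hline]; linarith) (hline t).le)
        (fun t => hmul _ (by change 1 - δ < _; rw [hline]; exact hAδ)) hε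
    have hhne : ∀ᶠ w in 𝓝[≠] s, h w ≠ 0 := by
      filter_upwards [hFne s hsδ, mem_nhdsWithin_of_mem_nhds (hUo.mem_nhds hsδ)] with w h₁ h₂ h₃
      exact h₁ (by rw [hmul w h₂, h₃, zero_mul])
    obtain ⟨L, hL, hzeros⟩ := exists_relativelyDense_zeros hstrip hUo hhan.differentiableOn hhM
      hper hσ₀₁ hσ₁s hs1 hs0 hhne
    refine not_tendsto_zeroCount_div hL (fun x => ?_) hσ
    obtain ⟨ρ, hρ0, hρ₁, hρ₂, hρ⟩ := hzeros x
    have hρU : ρ ∈ U := hstrip ρ (hσ₀₁.le.trans hρ₁) hρ₂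
    refine ⟨ρ, (hFan ρ hρU).analyticOrderAt_ne_zero.2 (by rw [hmul ρ hρU, hρ0, zero_mul]),
      ((le_max_right _ _).trans_lt hσ₁).trans_le hρ₁, hρ⟩
  constructor
  · rw [hmul s hsδ, mul_eq_zero, or_iff_right hne]
  · have hcongr : F =ᶠ[𝓝 s] h * f := by
      filter_upwards [hUo.mem_nhds hsδ] with z hz using hmul z hz
    rw [analyticOrderAt_congr hcongr, analyticOrderAt_mul (hhan s hsδ) (hfan s hsδ),
      (hhan s hsδ).analyticOrderAt_eq_zero.2 hne, zero_add]
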